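/- Let $M$ be a matroid on a finite ground set $E$, of rank $r$. Let $f_j(M)$ be the number of independent sets of $M$ of cardinality $j$, and let $$h_i(M)=\sum_{j=0}^{i}(-1)^{i-j}\binom{r-j}{r-i}f_j(M)\quad(0\le i\le r),\qquad h_i(M)=0\quad(i<0\text{ or }i>r),$$ be the $h$-vector of the independence complex of $M$. Write $\binom{m}{k}=\frac{m(m-1)\cdots(m-k+1)}{k!}$ for integers $m$ and $k\ge 0$, and $\binom{m}{k}=0$ for $k<0$. Let $U_{a,b}$ be the uniform matroid whose ground set has $b$ elements and whose independent sets are the subsets with at most $a$ elements. **Theorem.** (1) If $M$ has no coloops (that is, no element of $M$ lies in every basis), then for every integer $i$, $$h_{r-i}(M)\le\binom{r-1}{i}\,h_r(M)+\binom{r-1}{i-1}.$$ (2) For all integers $r\ge 1$ and $h\ge 1$, the matroid $$M=U_{1,h+1}\oplus\underbrace{U_{1,2}\oplus\cdots\oplus U_{1,2}}_{r-1}$$ has rank $r$, has no coloops, satisfies $h_r(M)=h$, and attains equality in (1) for every integer $i$. -/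

import Mathlib

namespace HVectors

/-! Finite abstract simplicial complexes are encoded as families of finite sets which are closed
under passing to subsets; the empty face belongs to every nonempty complex. -/

/-- The number `r` such that `Δ` has dimension `r - 1`: the largest cardinality of a face. -/
noncomputable def maxFaceCard {α : Type*} (Δ : LowerSet (Finset α)) : ℕ :=
  sSup {k : ℕ | ∃ A ∈ Δ, A.card = k}

/-- `f_j(Δ)`: the number of faces of `Δ` with exactly `j` elements. -/
noncomputable def fNumber {α : Type*} (Δ : LowerSet (Finset α)) (j : ℕ) : ℕ :=
  {A : Finset α | A ∈ Δ ∧ A.card = j}.ncard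

/-- `h_i(Δ) = ∑_{j=0}^{i} (-1)^{i-j} binom(r-j, r-i) f_j(Δ)` for `0 ≤ i ≤ r`, where `Δ` has
dimension `r - 1`; and `h_i(Δ) = 0` for `i < 0` and for `i > r`. -/
noncomputable def hNumber {α : Type*} (Δ : LowerSet (Finset α)) (i : ℤ) : ℤ :=
  if 0 ≤ i ∧ i ≤ (maxFaceCard Δ : ℤ) then
    ∑ j ∈ Finset.range (i.toNat + 1),
      (-1 : ℤ) ^ (i.toNat - j)
        * ((maxFaceCard Δ - j).choose (maxFaceCard Δ - i.toNat) : ℤ) * (fNumber Δ j : ℤ)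
  else 0

/-- The independence complex of a matroid. -/
def indepComplex {α : Type*} (M : Matroid α) : LowerSet (Finset α) where
  carrier := {A | M.Indep (A : Set α)}
  lower' _ _ hBA hA := hA.subset (Finset.coe_subset.2 hBA)

/-- `h_i(M)`, the `h`-vector of the independence complex of `M`. -/
noncomputable def matroidH {α : Type*} (M : Matroid α) (i : ℤ) : ℤ :=
  hNumber (indepComplex M) i

/-- The uniform matroid `U_{a,b}`: the ground set has `b` elements, and the independent sets are
the subsets with at most `a` elements. -/
def uniform (a b : ℕ) : Matroid (Fin b) :=
  (IndepMatroid.ofFinite (E := Set.univ) Set.finite_univ (fun I => I.ncard ≤ a)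
    (by simp)
    (fun _ J hJ hIJ => (Set.ncard_le_ncard hIJ J.toFinite).trans hJ)
    (fun I J _ hJ hlt => by
      obtain ⟨e, heJ, heI⟩ := Set.exists_mem_notMem_of_ncard_lt_ncard hlt I.toFinite
      refine ⟨e, heJ, heI, ?_⟩
      rw [Set.ncard_insert_of_notMem heI I.toFinite]
      omega)
    (fun _ _ => Set.subset_univ _)).matroid

/-- The direct sum `U_{1,m} ⊕ U_{1,2} ⊕ ⋯ ⊕ U_{1,2}` with `k` summands `U_{1,2}`. -/
def extremalMatroid (m k : ℕ) : Matroid (Fin m ⊕ (Fin k × Fin 2)) :=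
  (uniform 1 m).sum (Matroid.sum' fun _ : Fin k => uniform 1 2)

/-- The binomial coefficient `binom(n, k) = n (n-1) ⋯ (n-k+1) / k!` of integers, which is `0` for
`k < 0`. -/
def intChoose (n k : ℤ) : ℤ :=
  if 0 ≤ k then Ring.choose n k.toNat else 0

end HVectors

/-! The polynomial `∑ f_j (X - 1)^(r - j)` is `T_M(X, 1)`, and its coefficient of `X^i` is
`h_{r-i}`. Part (1) therefore says, for `r ≥ 1`, that without coloops `T_M(X, 1)` is coefficientwise
at most `(1 + X)^(r-1) (h_r + X)`.

Deletion-contraction proves this, but deletion may create coloops, so the induction needs a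
statement for all finite matroids. With `c` coloops, `X^c` divides `T_M(X, 1)`; let `g` (`coreTop`)
be the coefficient of `X^c`. The bound becomes `X^c (1 + X)^(r-c-1) (g + X)`, or `X^c` when `r = c`
(`hPoly_le`). Let `e` be neither a loop nor a coloop. If deleting `e` creates no coloop, then `g` is
additive and `extremalPoly_succ_add_le` closes the step. If it creates `s ≥ 1` coloops, then `g(M) =
g(M / e)`, and `X_pow_mul_extremalPoly_add_le` applies once `g(M \ e) ≤ g(M)` is known
(`coreTop_deleteElem_le`).

For part (2), independent sets are partial transversals of the summands, so the polynomial factors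
as `(h + X)(1 + X)^(r-1)`. -/

namespace HVectors

open Polynomial Matroid

/-! ### Face numbers, the polynomial `T_M(X, 1)`, and coloops under deletion -/

section Counting

variable {α : Type*} {M : Matroid α} {e f : α}

theorem mem_indepComplex {A : Finset α} : A ∈ indepComplex M ↔ M.Indep (A : Set α) := Iff.rfl

theorem maxFaceCard_indepComplex {r : ℕ} (h : M.eRank = r) :
    maxFaceCard (indepComplex M) = r := by
  obtain ⟨B, hB⟩ := M.exists_isBase
  have hBr : B.encard = r := hB.encard_eq_eRank.trans h
  have hfin : B.Finite := Set.finite_of_encard_eq_coe hBr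
  refine IsGreatest.csSup_eq ⟨⟨hfin.toFinset, ?_, ?_⟩, ?_⟩
  · simpa [mem_indepComplex] using hB.indep
  · rw [hfin.encard_eq_coe_toFinset_card] at hBr
    exact_mod_cast hBr
  · rintro k ⟨A, hA, rfl⟩
    have := (mem_indepComplex.1 hA).encard_le_eRank
    rw [h, Set.encard_coe_eq_coe_finsetCard] at this
    exact_mod_cast this

theorem fNumber_zero (M : Matroid α) : fNumber (indepComplex M) 0 = 1 := by
  have : {A : Finset α | A ∈ indepComplex M ∧ A.card = 0} = {∅} := by
    ext A
    simp only [Finset.card_eq_zero, Set.mem_ofPred_eq, Set.mem_singleton_iff, mem_indepComplex]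
    exact ⟨fun h => h.2, fun h => ⟨by simp [h], h⟩⟩
  rw [fNumber, this, Set.ncard_singleton]

theorem fNumber_eq_zero {r j : ℕ} (h : M.eRank = r) (hj : r < j) :
    fNumber (indepComplex M) j = 0 := by
  have : {A : Finset α | A ∈ indepComplex M ∧ A.card = j} = ∅ := by
    refine Set.eq_empty_of_forall_notMem ?_
    rintro A ⟨hA, rfl⟩
    have := (mem_indepComplex.1 hA).encard_le_eRank
    rw [h, Set.encard_coe_eq_coe_finsetCard] at this
    have : A.card ≤ r := by exact_mod_cast this
    omega
  rw [fNumber, this, Set.ncard_empty]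

theorem finite_faces (M : Matroid α) [M.Finite] (j : ℕ) :
    {A : Finset α | A ∈ indepComplex M ∧ A.card = j}.Finite := by
  refine (M.ground_finite.toFinset.powerset.finite_toSet).subset ?_
  rintro A ⟨hA, -⟩
  simpa [mem_indepComplex] using (mem_indepComplex.1 hA).subset_ground

theorem fNumber_delete_of_isLoop (he : M.IsLoop e) (j : ℕ) :
    fNumber (indepComplex (M ＼ {e})) j = fNumber (indepComplex M) j := by
  unfold fNumber
  congr 1
  ext A
  simp only [mem_indepComplex, deleteElem_indep_iff, Set.mem_ofPred_eq, and_congr_left_iff,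
    and_iff_left_iff_imp]
  exact fun _ hA => he.notMem_of_indep hA

/-- The `f`-numbers of the independence complex satisfy the deletion-contraction recursion. -/
theorem fNumber_succ [M.Finite] (he : M.IsNonloop e) (j : ℕ) :
    fNumber (indepComplex M) (j + 1) =
      fNumber (indepComplex (M ＼ {e})) (j + 1) + fNumber (indepComplex (M ／ {e})) j := by
  classical
  have hinj : Set.InjOn (fun A : Finset α => insert e A)
      {A : Finset α | A ∈ indepComplex (M ／ {e}) ∧ A.card = j} := by
    rintro A ⟨hA, -⟩ B ⟨hB, -⟩ hAB
    rw [mem_indepComplex, he.contractElem_indep_iff] at hA hB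
    have hA' : e ∉ A := by simpa using hA.1
    have hB' : e ∉ B := by simpa using hB.1
    simpa [hA', hB'] using congrArg (fun C : Finset α => C.erase e) hAB
  unfold fNumber
  rw [← hinj.ncard_image, ← Set.ncard_union_eq _ (finite_faces _ _) ((finite_faces _ _).image _)]
  · congr 1
    ext A
    simp only [Set.mem_ofPred_eq, Set.mem_union, Set.mem_image, mem_indepComplex,
      deleteElem_indep_iff, he.contractElem_indep_iff]
    constructor
    · rintro ⟨hA, hj⟩
      by_cases heA : e ∈ A
      · refine Or.inr ⟨A.erase e, ⟨⟨by simp, ?_⟩, ?_⟩, Finset.insert_erase heA⟩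
        · rw [← Finset.coe_insert, Finset.insert_erase heA]
          exact hA
        · rw [Finset.card_erase_of_mem heA, hj]
          rfl
      · exact Or.inl ⟨⟨hA, by simpa using heA⟩, hj⟩
    · rintro (⟨⟨hA, -⟩, hj⟩ | ⟨B, ⟨⟨heB, hB⟩, hj⟩, rfl⟩)
      · exact ⟨hA, hj⟩
      · refine ⟨by simpa using hB, ?_⟩
        rw [Finset.card_insert_of_notMem (by simpa using heB), hj]
  · rw [Set.disjoint_left]
    rintro A ⟨hA, -⟩ ⟨B, -, rfl⟩
    rw [mem_indepComplex, deleteElem_indep_iff] at hA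
    simp at hA

/-- The polynomial `∑_j f_j(M) (X - 1) ^ (r - j)`; when `r` is the rank of `M` it is the evaluation
`T_M(X, 1)` of the Tutte polynomial. -/
noncomputable def shiftedFPoly (M : Matroid α) (r : ℕ) : ℤ[X] :=
  ∑ j ∈ Finset.range (r + 1), (fNumber (indepComplex M) j : ℤ[X]) * (X - 1) ^ (r - j)

theorem shiftedFPoly_zero (M : Matroid α) : shiftedFPoly M 0 = 1 := by
  simp [shiftedFPoly, fNumber_zero]

theorem shiftedFPoly_delete_of_isLoop (he : M.IsLoop e) (r : ℕ) :
    shiftedFPoly (M ＼ {e}) r = shiftedFPoly M r := by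
  simp only [shiftedFPoly, fNumber_delete_of_isLoop he]

theorem shiftedFPoly_succ [M.Finite] (he : M.IsNonloop e) (r : ℕ) :
    shiftedFPoly M (r + 1) = shiftedFPoly (M ＼ {e}) (r + 1) + shiftedFPoly (M ／ {e}) r := by
  simp only [shiftedFPoly]
  rw [Finset.sum_range_succ' _ (r + 1), Finset.sum_range_succ' _ (r + 1)]
  simp only [fNumber_succ he, fNumber_zero, Nat.cast_add, add_mul, Finset.sum_add_distrib,
    Nat.add_sub_add_right]
  ring

theorem shiftedFPoly_succ_of_eRank_eq {r : ℕ} (h : M.eRank = r) :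
    shiftedFPoly M (r + 1) = (X - 1) * shiftedFPoly M r := by
  rw [shiftedFPoly, Finset.sum_range_succ, fNumber_eq_zero h (Nat.lt_succ_self r), shiftedFPoly,
    Finset.mul_sum]
  simp only [Nat.cast_zero, zero_mul, add_zero]
  refine Finset.sum_congr rfl fun j hj => ?_
  rw [Nat.sub_add_comm (by simpa [Nat.lt_succ_iff] using hj), pow_succ]
  ring

/-- The entry `h_i` is the coefficient of `X ^ (r - i)` in `∑_j f_j (X - 1) ^ (r - j)`. -/
theorem matroidH_eq_coeff {r : ℕ} (h : M.eRank = r) {i : ℕ} (hi : i ≤ r) :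
    matroidH M ((r : ℤ) - i) = (shiftedFPoly M r).coeff i := by
  have hcast : (r : ℤ) - i = ((r - i : ℕ) : ℤ) := by push_cast [hi]; rfl
  rw [matroidH, hNumber, maxFaceCard_indepComplex h, hcast, if_pos ⟨by positivity, by simp⟩,
    Int.toNat_natCast, Nat.sub_sub_self hi, shiftedFPoly, finsetSum_coeff]
  have hsub : Finset.range (r - i + 1) ⊆ Finset.range (r + 1) :=
    Finset.range_subset_range.2 (by omega)
  rw [← Finset.sum_subset hsub]
  · refine Finset.sum_congr rfl fun j hj => ?_
    have hj' : j ≤ r - i := by simpa [Nat.lt_succ_iff] using hj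
    rw [← C_eq_natCast, coeff_C_mul, ← C_1, sub_eq_add_neg, ← C_neg, coeff_X_add_C_pow,
      show r - j - i = r - i - j by omega]
    ring
  -- For `j > r - i` the power `(X - 1)^(r - j)` has degree below `i`.
  · intro j hjr hj
    have hjr' : j ≤ r := by simpa [Nat.lt_succ_iff] using hjr
    have hj' : r - i < j := by simpa [Nat.lt_succ_iff] using hj
    rw [← C_eq_natCast, coeff_C_mul, ← C_1, sub_eq_add_neg, ← C_neg, coeff_X_add_C_pow,
      Nat.choose_eq_zero_of_lt (by omega)]
    simp

theorem matroidH_sub_of_neg {r : ℕ} (h : M.eRank = r) {i : ℤ} (hi : i < 0) :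
    matroidH M (r - i) = 0 := by
  rw [matroidH, hNumber, maxFaceCard_indepComplex h, if_neg (by omega)]

theorem matroidH_sub_of_lt {r : ℕ} {i : ℤ} (hi : r < i) : matroidH M (r - i) = 0 := by
  rw [matroidH, hNumber, if_neg (by omega)]

theorem eRank_contractElem (he : M.IsNonloop e) : (M ／ {e}).eRank + 1 = M.eRank := by
  obtain ⟨B, hB⟩ := (M ／ {e}).exists_isBase
  have hB' := he.indep.contract_isBase_iff.1 hB
  rw [← hB.encard_eq_eRank, ← hB'.1.encard_eq_eRank, Set.encard_union_eq hB'.2,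
    Set.encard_singleton]

theorem eRank_deleteElem (hc : ¬ M.IsColoop e) : (M ＼ {e}).eRank = M.eRank := by
  rw [isColoop_iff_sdiff_not_spanning, not_not] at hc
  exact hc.eRank_restrict

theorem isColoop_deleteElem_of_isColoop (hf : M.IsColoop f) (hfe : f ≠ e) :
    (M ＼ {e}).IsColoop f := by
  rw [delete_isColoop_iff]
  exact ⟨hf.notMem_closure_of_notMem (by simp), hf.mem_ground, by simpa using hfe⟩

/-- Being in series is symmetric. If `e` lay in the closure of `E \ {e, f}`, that closure would
equal the closure of `E \ {f}`, which contains `f` because `f` is not a coloop of `M`. -/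
theorem isColoop_deleteElem_symm (he : e ∈ M.E) (hf : ¬ M.IsColoop f)
    (h : (M ＼ {e}).IsColoop f) : (M ＼ {f}).IsColoop e := by
  rw [delete_isColoop_iff] at h ⊢
  obtain ⟨hcl, hfE, hfe⟩ := h
  refine ⟨fun hmem => hcl ?_, he, fun h => hfe h.symm⟩
  rw [isColoop_iff_notMem_closure_compl hfE, not_not] at hf
  rw [Set.sdiff_sdiff_comm] at hmem
  rw [← M.closure_insert_eq_of_mem_closure hmem, Set.sdiff_sdiff_comm,
    Set.insert_sdiff_singleton]
  exact M.closure_subset_closure (Set.subset_insert _ _) hf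

end Counting

/-! ### Coefficientwise inequalities between the extremal polynomials -/

/-- Coefficientwise comparison of polynomials. -/
def CoeffLE (p q : ℤ[X]) : Prop := ∀ n, p.coeff n ≤ q.coeff n

namespace CoeffLE

variable {p q s p' q' : ℤ[X]}

theorem refl (p : ℤ[X]) : CoeffLE p p := fun _ => le_rfl

theorem trans (h : CoeffLE p q) (h' : CoeffLE q s) : CoeffLE p s := fun n => (h n).trans (h' n)

theorem add (h : CoeffLE p q) (h' : CoeffLE p' q') : CoeffLE (p + p') (q + q') := fun n => by
  simpa using add_le_add (h n) (h' n)

theorem nonneg_mul (h : CoeffLE 0 p) (h' : CoeffLE 0 q) : CoeffLE 0 (p * q) := fun n => by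
  rw [coeff_mul, coeff_zero]
  exact Finset.sum_nonneg fun x _ => mul_nonneg (h x.1) (h' x.2)

theorem iff_sub_nonneg : CoeffLE p q ↔ CoeffLE 0 (q - p) := by simp [CoeffLE]

theorem mul_left (h : CoeffLE p q) (hs : CoeffLE 0 s) : CoeffLE (s * p) (s * q) := by
  rw [iff_sub_nonneg] at h ⊢
  rw [← mul_sub]
  exact hs.nonneg_mul h

theorem nonneg_X : CoeffLE 0 X := fun n => by
  rw [coeff_X, coeff_zero]
  split_ifs <;> simp

theorem nonneg_C {a : ℤ} (ha : 0 ≤ a) : CoeffLE 0 (C a) := fun n => by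
  rw [coeff_C, coeff_zero]
  split_ifs <;> simp [ha]

theorem nonneg_one : CoeffLE 0 1 := nonneg_C zero_le_one

theorem nonneg_add (h : CoeffLE 0 p) (h' : CoeffLE 0 q) : CoeffLE 0 (p + q) := by
  simpa using h.add h'

theorem nonneg_pow (h : CoeffLE 0 p) (n : ℕ) : CoeffLE 0 (p ^ n) := by
  induction n with
  | zero => simpa using nonneg_one
  | succ n ih => exact pow_succ p n ▸ ih.nonneg_mul h

theorem X_pow_le_one_add_X_pow (n : ℕ) : CoeffLE (X ^ n) ((1 + X) ^ n) := by
  induction n with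
  | zero => simpa using refl 1
  | succ n ih =>
    rw [pow_succ', pow_succ']
    refine (ih.mul_left nonneg_X).trans ?_
    rw [iff_sub_nonneg, show (1 + X : ℤ[X]) * (1 + X) ^ n - X * (1 + X) ^ n = (1 + X) ^ n by ring]
    exact (nonneg_one.nonneg_add nonneg_X).nonneg_pow n

end CoeffLE

/-- The `h`-polynomial `(1 + X) ^ (k - 1) * (g + X)` of the extremal matroid of rank `k`. -/
noncomputable def extremalPoly : ℕ → ℤ → ℤ[X]
  | 0, _ => 1
  | k + 1, g => (1 + X) ^ k * (C g + X)

theorem nonneg_one_add_X_pow (n : ℕ) : CoeffLE 0 ((1 + X) ^ n) :=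
  (CoeffLE.nonneg_one.nonneg_add CoeffLE.nonneg_X).nonneg_pow n

theorem nonneg_extremalPoly (k : ℕ) {g : ℤ} (hg : 0 ≤ g) : CoeffLE 0 (extremalPoly k g) := by
  cases k with
  | zero => exact CoeffLE.nonneg_one
  | succ k =>
    exact (nonneg_one_add_X_pow k).nonneg_mul ((CoeffLE.nonneg_C hg).nonneg_add CoeffLE.nonneg_X)

/-- The difference of the two sides is `g₂ - 1` for `m = 0` and `(1 + X)^(m-1) X (g₂ - 1)`
otherwise. This is the inductive step when deletion creates no coloop. -/
theorem extremalPoly_succ_add_le (m : ℕ) (g₁ : ℤ) {g₂ : ℤ} (hg₂ : 1 ≤ g₂) :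
    CoeffLE (extremalPoly (m + 1) g₁ + extremalPoly m g₂) (extremalPoly (m + 1) (g₁ + g₂)) := by
  rw [CoeffLE.iff_sub_nonneg]
  cases m with
  | zero =>
    convert CoeffLE.nonneg_C (sub_nonneg.2 hg₂) using 1
    simp only [extremalPoly, C_add, C_sub, C_1]
    ring
  | succ m =>
    convert (nonneg_one_add_X_pow m).nonneg_mul
      (CoeffLE.nonneg_X.nonneg_mul (CoeffLE.nonneg_C (sub_nonneg.2 hg₂))) using 1
    simp only [extremalPoly, C_add, C_sub, C_1]
    ring

/-- The inductive step when deletion creates `s` coloops. For `m ≥ 1` the two extremal polynomials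
with parameter `g` differ by `X (1 + X)^(m-1) (g + X)`; one factor `X` of `X^s` matches the leading
`X`, and the other factors are bounded by powers of `1 + X`. -/
theorem X_pow_mul_extremalPoly_add_le {m s : ℕ} {g₁ g : ℤ} (hs : 1 ≤ s) (hsm : s ≤ m + 1)
    (hg₁ : g₁ ≤ g) (hg : 1 ≤ g) :
    CoeffLE (X ^ s * extremalPoly (m + 1 - s) g₁ + extremalPoly m g) (extremalPoly (m + 1) g) := by
  cases m with
  | zero =>
    obtain rfl : s = 1 := by omega
    rw [CoeffLE.iff_sub_nonneg]
    convert CoeffLE.nonneg_C (sub_nonneg.2 hg) using 1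
    simp only [extremalPoly, C_sub, C_1, zero_add, Nat.sub_self, pow_one, pow_zero, mul_one,
      one_mul]
    ring
  | succ m =>
    have key : CoeffLE (X ^ s * extremalPoly (m + 1 + 1 - s) g₁)
        (X * (1 + X) ^ m * (C g + X)) := by
      obtain ⟨s, rfl⟩ : ∃ t, s = t + 1 := ⟨s - 1, by omega⟩
      obtain rfl | hlt : s = m + 1 ∨ s ≤ m := by omega
      -- Here the remaining rank is zero, so the extremal polynomial is `1` and the factor `g₁ + X`
      -- is absent; a second `X` is matched with the `X` in `g + X`.
      · simp only [Nat.sub_self, extremalPoly, mul_one]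
        refine CoeffLE.trans (q := X * (X * (1 + X) ^ m)) ?_ ?_
        · rw [pow_succ', pow_succ']
          exact ((CoeffLE.X_pow_le_one_add_X_pow m).mul_left CoeffLE.nonneg_X).mul_left
            CoeffLE.nonneg_X
        · rw [CoeffLE.iff_sub_nonneg]
          convert (CoeffLE.nonneg_X.nonneg_mul (nonneg_one_add_X_pow m)).nonneg_mul
            (CoeffLE.nonneg_C (zero_le_one.trans hg)) using 1
          ring
      · obtain ⟨t, rfl⟩ := Nat.exists_eq_add_of_le hlt
        rw [show s + t + 1 + 1 - (s + 1) = t + 1 by omega]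
        refine CoeffLE.trans (q := X ^ (s + 1) * ((1 + X) ^ t * (C g + X))) ?_ ?_
        · refine CoeffLE.mul_left (CoeffLE.mul_left ?_ (nonneg_one_add_X_pow t))
            (CoeffLE.nonneg_X.nonneg_pow _)
          rw [CoeffLE.iff_sub_nonneg]
          convert CoeffLE.nonneg_C (sub_nonneg.2 hg₁) using 1
          simp only [C_sub]
          ring
        · convert (CoeffLE.X_pow_le_one_add_X_pow s).mul_left
            (CoeffLE.nonneg_X.nonneg_mul (nonneg_extremalPoly (t + 1) (zero_le_one.trans hg)))
            using 1 <;> simp only [extremalPoly] <;> ring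
    refine (key.add (CoeffLE.refl _)).trans ?_
    convert CoeffLE.refl (extremalPoly (m + 1 + 1) g) using 1
    simp only [extremalPoly]
    ring

/-! ### The deletion-contraction induction for the upper bound -/

section Matroid

variable {α : Type*} {M : Matroid α} {e f : α}

/-- The rank of a matroid of finite rank, as a natural number. -/
noncomputable def natRank (M : Matroid α) : ℕ := M.eRank.toNat

theorem coe_natRank (M : Matroid α) [M.RankFinite] : (natRank M : ℕ∞) = M.eRank :=
  ENat.natCast_toNat (M.eRank_ne_top_iff.2 inferInstance)

theorem natRank_contractElem [M.RankFinite] (he : M.IsNonloop e) :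
    natRank M = natRank (M ／ {e}) + 1 := by
  have := eRank_contractElem he
  rw [← coe_natRank, ← coe_natRank] at this
  exact_mod_cast this.symm

theorem natRank_deleteElem (hc : ¬ M.IsColoop e) : natRank (M ＼ {e}) = natRank M := by
  rw [natRank, eRank_deleteElem hc, natRank]

/-- The evaluation `T_M(X, 1)` of the Tutte polynomial, whose coefficients are the `h`-numbers. -/
noncomputable def hPoly (M : Matroid α) : ℤ[X] := shiftedFPoly M (natRank M)

/-- The number of coloops. -/
noncomputable def numColoops (M : Matroid α) : ℕ := M.coloops.ncard

/-- The top `h`-number of the matroid that is left after deleting all coloops. -/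
noncomputable def coreTop (M : Matroid α) : ℤ := (hPoly M).coeff (numColoops M)

theorem finite_coloops (M : Matroid α) [M.Finite] : M.coloops.Finite :=
  M.ground_finite.subset M.coloops_subset_ground

theorem contractElem_eq_deleteElem_of_isLoop (he : M.IsLoop e) : M ／ {e} = M ＼ {e} :=
  contract_eq_delete_of_subset_loops (Set.singleton_subset_iff.2 he)

theorem contractElem_eq_deleteElem_of_isColoop (he : M.IsColoop e) : M ／ {e} = M ＼ {e} :=
  contract_eq_delete_of_subset_coloops (Set.singleton_subset_iff.2 he)

theorem numColoops_contractElem (he : ¬ M.IsColoop e) : numColoops (M ／ {e}) = numColoops M := by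
  rw [numColoops, contract_coloops_eq, Set.sdiff_singleton_eq_self (by exact he), numColoops]

section Loop

theorem hPoly_of_isLoop (he : M.IsLoop e) : hPoly (M ＼ {e}) = hPoly M := by
  rw [hPoly, natRank_deleteElem he.not_isColoop, shiftedFPoly_delete_of_isLoop he, hPoly]

theorem numColoops_of_isLoop (he : M.IsLoop e) : numColoops (M ＼ {e}) = numColoops M := by
  rw [← contractElem_eq_deleteElem_of_isLoop he, numColoops_contractElem he.not_isColoop]

theorem coreTop_of_isLoop (he : M.IsLoop e) : coreTop (M ＼ {e}) = coreTop M := by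
  rw [coreTop, hPoly_of_isLoop he, numColoops_of_isLoop he, coreTop]

end Loop

section Coloop

theorem natRank_of_isColoop [M.RankFinite] (he : M.IsColoop e) :
    natRank M = natRank (M ＼ {e}) + 1 := by
  rw [natRank_contractElem he.isNonloop, contractElem_eq_deleteElem_of_isColoop he]

theorem numColoops_of_isColoop [M.Finite] (he : M.IsColoop e) :
    numColoops M = numColoops (M ＼ {e}) + 1 := by
  rw [← contractElem_eq_deleteElem_of_isColoop he, numColoops, numColoops, contract_coloops_eq,
    Set.ncard_sdiff_singleton_add_one (by exact he) (finite_coloops M)]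

theorem hPoly_of_isColoop [M.Finite] (he : M.IsColoop e) :
    hPoly M = X * hPoly (M ＼ {e}) := by
  rw [hPoly, natRank_of_isColoop he, shiftedFPoly_succ he.isNonloop,
    contractElem_eq_deleteElem_of_isColoop he, shiftedFPoly_succ_of_eRank_eq (coe_natRank _).symm,
    hPoly]
  ring

theorem coreTop_of_isColoop [M.Finite] (he : M.IsColoop e) : coreTop (M ＼ {e}) = coreTop M := by
  rw [coreTop, coreTop, hPoly_of_isColoop he, numColoops_of_isColoop he, coeff_X_mul]

end Coloop

section Ordinary

theorem hPoly_eq_add [M.Finite] (he : M.IsNonloop e) (hc : ¬ M.IsColoop e) :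
    hPoly M = hPoly (M ＼ {e}) + hPoly (M ／ {e}) := by
  rw [hPoly, hPoly, hPoly, natRank_deleteElem hc, natRank_contractElem he, shiftedFPoly_succ he]

theorem coloops_subset_coloops_deleteElem (hc : ¬ M.IsColoop e) :
    M.coloops ⊆ (M ＼ {e}).coloops := fun _ hf =>
  isColoop_deleteElem_of_isColoop hf fun h => hc (h ▸ hf)

theorem numColoops_le_deleteElem [M.Finite] (hc : ¬ M.IsColoop e) :
    numColoops M ≤ numColoops (M ＼ {e}) :=
  Set.ncard_le_ncard (coloops_subset_coloops_deleteElem hc) (finite_coloops _)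

theorem numColoops_le_natRank (M : Matroid α) [M.Finite] : numColoops M ≤ natRank M := by
  have h := M.coloops_indep.encard_le_eRank
  rw [← coe_natRank, ← (finite_coloops M).cast_ncard_eq] at h
  exact_mod_cast h

theorem numColoops_lt_natRank [M.Finite] (he : M.IsNonloop e) (hc : ¬ M.IsColoop e) :
    numColoops M < natRank M := by
  rw [← numColoops_contractElem hc, natRank_contractElem he, Nat.lt_succ_iff]
  exact numColoops_le_natRank _

theorem coreTop_eq_add [M.Finite] (he : M.IsNonloop e) (hc : ¬ M.IsColoop e) :
    coreTop M = (hPoly (M ＼ {e})).coeff (numColoops M) + coreTop (M ／ {e}) := by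
  rw [coreTop, hPoly_eq_add he hc, coeff_add, coreTop, numColoops_contractElem hc]

end Ordinary

theorem ncard_ground_sdiff_lt [M.Finite] (he : e ∈ M.E) : (M.E \ {e}).ncard < M.E.ncard :=
  Set.ncard_sdiff_singleton_lt_of_mem he M.ground_finite

theorem natRank_of_ground_eq_empty (h : M.E = ∅) : natRank M = 0 := by
  rw [natRank, Matroid.ground_eq_empty_iff.1 h]
  simp

theorem numColoops_of_ground_eq_empty (h : M.E = ∅) : numColoops M = 0 := by
  rw [numColoops, Set.subset_eq_empty M.coloops_subset_ground h, Set.ncard_empty]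

theorem hPoly_of_ground_eq_empty (h : M.E = ∅) : hPoly M = 1 := by
  rw [hPoly, natRank_of_ground_eq_empty h, shiftedFPoly_zero]

/-- Induction on finite matroids by deletion and contraction of an element. -/
theorem deletion_contraction_induction {motive : Matroid α → Prop}
    (empty : ∀ M : Matroid α, M.E = ∅ → motive M)
    (loop : ∀ (M : Matroid α) [M.Finite] (e : α), M.IsLoop e → motive (M ＼ {e}) → motive M)
    (coloop : ∀ (M : Matroid α) [M.Finite] (e : α), M.IsColoop e → motive (M ＼ {e}) → motive M)
    (ordinary : ∀ (M : Matroid α) [M.Finite] (e : α), M.IsNonloop e → ¬ M.IsColoop e →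
      motive (M ＼ {e}) → motive (M ／ {e}) → motive M)
    (M : Matroid α) [M.Finite] : motive M := by
  induction hn : M.E.ncard using Nat.strong_induction_on generalizing M with
  | _ n ih =>
    obtain h | ⟨e, he⟩ := M.E.eq_empty_or_nonempty
    · exact empty M h
    have hlt := ncard_ground_sdiff_lt he
    have hdel : motive (M ＼ {e}) := ih _ (by rw [← hn]; exact hlt) _ rfl
    have hcon : motive (M ／ {e}) := ih _ (by rw [← hn]; exact hlt) _ rfl
    obtain hl | hl := M.isLoop_or_isNonloop e
    · exact loop M e hl hdel
    · by_cases hc : M.IsColoop e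
      · exact coloop M e hc hdel
      · exact ordinary M e hl hc hdel hcon

/-- Each coloop contributes a factor `X`, while deleting or contracting an ordinary element never
loses a coloop. -/
theorem X_pow_numColoops_dvd_hPoly (M : Matroid α) [M.Finite] :
    X ^ numColoops M ∣ hPoly M := by
  induction M using deletion_contraction_induction with
  | empty M h => simp [numColoops_of_ground_eq_empty h]
  | loop M e he ih => rwa [← hPoly_of_isLoop he, ← numColoops_of_isLoop he]
  | coloop M e he ih =>
    rw [hPoly_of_isColoop he, numColoops_of_isColoop he, pow_succ']
    exact mul_dvd_mul_left _ ih
  | ordinary M e he hc ih ih' =>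
    rw [hPoly_eq_add he hc]
    rw [numColoops_contractElem hc] at ih'
    exact dvd_add ((pow_dvd_pow _ (numColoops_le_deleteElem hc)).trans ih) ih'

theorem coeff_hPoly_eq_zero (M : Matroid α) [M.Finite] {n : ℕ} (hn : n < numColoops M) :
    (hPoly M).coeff n = 0 :=
  X_pow_dvd_iff.1 (X_pow_numColoops_dvd_hPoly M) n hn

theorem coreTop_of_lt [M.Finite] (he : M.IsNonloop e) (hc : ¬ M.IsColoop e)
    (h : numColoops M < numColoops (M ＼ {e})) : coreTop M = coreTop (M ／ {e}) := by
  rw [coreTop_eq_add he hc, coeff_hPoly_eq_zero _ h, zero_add]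

theorem coreTop_of_eq [M.Finite] (he : M.IsNonloop e) (hc : ¬ M.IsColoop e)
    (h : numColoops M = numColoops (M ＼ {e})) :
    coreTop M = coreTop (M ＼ {e}) + coreTop (M ／ {e}) := by
  rw [coreTop_eq_add he hc, h, coreTop.eq_def (M ＼ {e})]

theorem one_le_coreTop (M : Matroid α) [M.Finite] : 1 ≤ coreTop M := by
  induction M using deletion_contraction_induction with
  | empty M h => simp [coreTop, hPoly_of_ground_eq_empty h, numColoops_of_ground_eq_empty h]
  | loop M e he ih => rwa [← coreTop_of_isLoop he]
  | coloop M e he ih => rwa [← coreTop_of_isColoop he]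
  | ordinary M e he hc ih ih' =>
    obtain h | h := (numColoops_le_deleteElem hc).eq_or_lt
    · rw [coreTop_of_eq he hc h]
      linarith
    · rwa [coreTop_of_lt he hc h]

/-- If deleting `e` creates a coloop `f`, then `e` and `f` are in series. Contracting `f` leaves
`coreTop` unchanged both in `M` and in `M ＼ {e}`, so the claim passes to the smaller matroid `M ／
{f}`. -/
theorem coreTop_deleteElem_le (M : Matroid α) [M.Finite] (e : α) (he : e ∈ M.E) :
    coreTop (M ＼ {e}) ≤ coreTop M := by
  induction hn : M.E.ncard using Nat.strong_induction_on generalizing M with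
  | _ n ih =>
    obtain hl | hl := M.isLoop_or_isNonloop e
    · exact (coreTop_of_isLoop hl).le
    by_cases hc : M.IsColoop e
    · exact (coreTop_of_isColoop hc).le
    obtain h | h := (numColoops_le_deleteElem hc).eq_or_lt
    · rw [coreTop_of_eq hl hc h]
      linarith [one_le_coreTop (M ／ {e})]
    obtain ⟨f, hf, hfM⟩ := Set.exists_mem_notMem_of_ncard_lt_ncard h (finite_coloops M)
    replace hf : (M ＼ {e}).IsColoop f := hf
    have hfe : f ≠ e := by
      rintro rfl
      exact hf.mem_ground.2 rfl
    have hfn : M.IsNonloop f := hf.isNonloop.of_delete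
    have heM : (M ＼ {f}).IsColoop e := isColoop_deleteElem_symm he hfM hf
    have hlt : numColoops M < numColoops (M ＼ {f}) :=
      Set.ncard_lt_ncard ((Set.ssubset_iff_of_subset
        (coloops_subset_coloops_deleteElem hfM)).2 ⟨e, heM, hc⟩) (finite_coloops _)
    rw [coreTop_of_lt hfn hfM hlt, ← coreTop_of_isColoop hf,
      ← contractElem_eq_deleteElem_of_isColoop hf,
      ← contract_delete_comm _ (by simpa using hfe)]
    refine ih _ ?_ _ ⟨he, by simpa using hfe.symm⟩ rfl
    rw [← hn]
    exact ncard_ground_sdiff_lt hfn.mem_ground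

/-- The coefficientwise upper bound for `T_M(X, 1)`. -/
theorem hPoly_le (M : Matroid α) [M.Finite] :
    CoeffLE (hPoly M)
      (X ^ numColoops M * extremalPoly (natRank M - numColoops M) (coreTop M)) := by
  induction M using deletion_contraction_induction with
  | empty M h =>
    rw [hPoly_of_ground_eq_empty h, numColoops_of_ground_eq_empty h, natRank_of_ground_eq_empty h]
    simpa [extremalPoly] using CoeffLE.refl 1
  | loop M e he ih =>
    rwa [hPoly_of_isLoop he, numColoops_of_isLoop he, natRank_deleteElem he.not_isColoop,
      coreTop_of_isLoop he] at ih
  | coloop M e he ih =>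
    rw [hPoly_of_isColoop he, numColoops_of_isColoop he, natRank_of_isColoop he,
      ← coreTop_of_isColoop he, Nat.add_sub_add_right, pow_succ', mul_assoc]
    exact ih.mul_left CoeffLE.nonneg_X
  | ordinary M e he hc ih ih' =>
    obtain ⟨m, hm⟩ : ∃ m, natRank M = numColoops M + m + 1 :=
      ⟨natRank M - numColoops M - 1, by have := numColoops_lt_natRank he hc; omega⟩
    have hle : numColoops (M ＼ {e}) ≤ natRank M :=
      natRank_deleteElem hc ▸ numColoops_le_natRank (M ＼ {e})
    have hr := natRank_contractElem he
    rw [natRank_deleteElem hc] at ih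
    rw [numColoops_contractElem hc, show natRank (M ／ {e}) - numColoops M = m by omega] at ih'
    rw [hPoly_eq_add he hc, show natRank M - numColoops M = m + 1 by omega]
    refine (ih.add ih').trans ?_
    -- The bounds for deletion and contraction share the factor `X ^ numColoops M`; what remains is
    -- one of the two polynomial inequalities.
    obtain h | h := (numColoops_le_deleteElem hc).eq_or_lt
    · rw [← h, ← mul_add, show natRank M - numColoops M = m + 1 by omega, coreTop_of_eq he hc h]
      exact (extremalPoly_succ_add_le m _ (one_le_coreTop _)).mul_left
        (CoeffLE.nonneg_X.nonneg_pow _)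
    · obtain ⟨s, hs⟩ := Nat.exists_eq_add_of_le h.le
      rw [hs, pow_add, mul_assoc, ← mul_add,
        show natRank M - (numColoops M + s) = m + 1 - s by omega, ← coreTop_of_lt he hc h]
      exact (X_pow_mul_extremalPoly_add_le (by omega) (by omega)
        (coreTop_deleteElem_le M e he.mem_ground) (one_le_coreTop M)).mul_left
        (CoeffLE.nonneg_X.nonneg_pow _)

/-! ### From coefficients to the binomial bound -/

theorem intChoose_natCast (n i : ℕ) : intChoose n i = n.choose i := by
  simp [intChoose, Ring.choose_natCast]

theorem intChoose_of_neg {n i : ℤ} (hi : i < 0) : intChoose n i = 0 := by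
  simp [intChoose, hi]

theorem coeff_extremalPoly_succ (k i : ℕ) (g : ℤ) :
    (extremalPoly (k + 1) g).coeff i = intChoose k i * g + intChoose k ((i : ℤ) - 1) := by
  rw [extremalPoly, mul_add, coeff_add, coeff_mul_C, coeff_one_add_X_pow, intChoose_natCast]
  cases i with
  | zero => simp [intChoose_of_neg]
  | succ i =>
    rw [coeff_mul_X, coeff_one_add_X_pow, Nat.cast_succ, add_sub_cancel_right, intChoose_natCast]

theorem matroidH_eq_coeff_hPoly [M.Finite] {r : ℕ} (h : M.eRank = r) {i : ℕ} (hi : i ≤ r) :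
    matroidH M ((r : ℤ) - i) = (hPoly M).coeff i := by
  rw [matroidH_eq_coeff h hi, hPoly, natRank, h, ENat.toNat_natCast]

theorem intChoose_eq_zero_of_notMem {k : ℕ} {i : ℤ} (hi : i < 0 ∨ k < i) : intChoose k i = 0 := by
  obtain hi | hi := hi
  · exact intChoose_of_neg hi
  · lift i to ℕ using by omega
    rw [intChoose_natCast, Nat.choose_eq_zero_of_lt (by exact_mod_cast hi), Nat.cast_zero]

/-- Pascal's rule with upper index `0`. It makes the right side of the bound vanish in rank `0` for
positive `i`. -/
theorem intChoose_neg_one_succ (i : ℕ) :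
    intChoose (-1) ((i + 1 : ℕ) : ℤ) + intChoose (-1) i = 0 := by
  have h := Ring.choose_succ_succ (-1 : ℤ) i
  rw [neg_add_cancel, Ring.choose_zero_succ] at h
  simp only [intChoose, Nat.cast_nonneg, if_true, Int.toNat_natCast]
  rw [add_comm, ← h]

theorem matroidH_le [M.Finite] {r : ℕ} (h : M.eRank = r) (hc : ∀ e, ¬ M.IsColoop e) (i : ℤ) :
    matroidH M (r - i) ≤
      intChoose ((r : ℤ) - 1) i * matroidH M r + intChoose ((r : ℤ) - 1) (i - 1) := by
  have hrank : natRank M = r := by rw [natRank, h, ENat.toNat_natCast]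
  have hcol : numColoops M = 0 := by
    rw [numColoops, Set.eq_empty_of_forall_notMem (s := M.coloops) hc, Set.ncard_empty]
  have htop : matroidH M r = coreTop M := by
    simpa [coreTop, hcol] using matroidH_eq_coeff_hPoly h (Nat.zero_le r)
  have hle := hPoly_le M
  rw [hrank, hcol, pow_zero, one_mul, Nat.sub_zero, ← htop] at hle
  obtain hi | hi := lt_or_ge i 0
  · rw [matroidH_sub_of_neg h hi, intChoose_of_neg hi, intChoose_of_neg (by omega)]
    simp
  lift i to ℕ using hi
  cases r with
  | zero =>
    -- In rank `0` the upper index `r - 1` is `-1`, outside the polynomial form of the bound, so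
    -- this case is computed directly.
    have h1 : matroidH M (0 : ℕ) = 1 := by
      refine le_antisymm ?_ (htop ▸ one_le_coreTop M)
      simpa [extremalPoly, matroidH_eq_coeff_hPoly h le_rfl] using
        (matroidH_eq_coeff_hPoly h le_rfl).trans_le (hle 0)
    cases i with
    | zero =>
      rw [h1]
      simp at h1
      simp [h1, intChoose]
    | succ i =>
      rw [matroidH_sub_of_lt (by positivity), h1]
      simp only [Nat.cast_zero, zero_sub, Nat.cast_succ, add_sub_cancel_right, mul_one]
      exact (intChoose_neg_one_succ i).ge
  | succ k =>
    rw [Nat.cast_succ, add_sub_cancel_right, ← Nat.cast_succ]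
    obtain hik | hik := le_or_gt i (k + 1)
    · rw [matroidH_eq_coeff_hPoly h hik, ← coeff_extremalPoly_succ]
      exact hle i
    · rw [matroidH_sub_of_lt (by exact_mod_cast hik),
        intChoose_eq_zero_of_notMem (Or.inr (by omega)),
        intChoose_eq_zero_of_notMem (Or.inr (by omega))]
      simp

end Matroid

/-! ### The extremal matroids -/

theorem uniform_indep_iff {a b : ℕ} {I : Set (Fin b)} : (uniform a b).Indep I ↔ I.ncard ≤ a := by
  simp [uniform]

theorem uniform_one_indep_iff {b : ℕ} {I : Set (Fin b)} :
    (uniform 1 b).Indep I ↔ I.Subsingleton := by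
  rw [uniform_indep_iff, Set.ncard_le_one_iff_subsingleton]

theorem extremalMatroid_indep_iff {m k : ℕ} {I : Set (Fin m ⊕ (Fin k × Fin 2))} :
    (extremalMatroid m k).Indep I ↔ (Sum.inl ⁻¹' I).Subsingleton ∧
      ∀ i, ((fun b => Sum.inr (i, b)) ⁻¹' I).Subsingleton := by
  simp [extremalMatroid, uniform_one_indep_iff, Set.preimage_preimage]

instance finite_extremalMatroid (m k : ℕ) : (extremalMatroid m k).Finite :=
  ⟨Set.toFinite _⟩

/-- The transversal that picks at most one element from each summand `U_{1,b}`. -/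
def transversal {m k : ℕ} (x : Option (Fin m) × (Fin k → Option (Fin 2))) :
    Finset (Fin m ⊕ (Fin k × Fin 2)) :=
  Finset.disjSum x.1.toFinset (Finset.univ.filter fun p => x.2 p.1 = some p.2)

theorem inl_mem_transversal {m k : ℕ} {x : Option (Fin m) × (Fin k → Option (Fin 2))} {a : Fin m} :
    Sum.inl a ∈ transversal x ↔ x.1 = some a := by
  simp [transversal, eq_comm]

theorem inr_mem_transversal {m k : ℕ} {x : Option (Fin m) × (Fin k → Option (Fin 2))}
    {p : Fin k × Fin 2} : Sum.inr p ∈ transversal x ↔ x.2 p.1 = some p.2 := by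
  simp [transversal]

theorem transversal_injective (m k : ℕ) : Function.Injective (transversal (m := m) (k := k)) := by
  rintro ⟨o, φ⟩ ⟨o', φ'⟩ h
  refine Prod.ext (Option.ext fun a => ?_) (funext fun i => Option.ext fun b => ?_)
  · simpa [inl_mem_transversal] using Finset.ext_iff.1 h (Sum.inl a)
  · simpa [inr_mem_transversal] using Finset.ext_iff.1 h (Sum.inr (i, b))

theorem exists_option_of_subsingleton {β : Type*} {s : Set β} (hs : s.Subsingleton) :
    ∃ o : Option β, ∀ a, o = some a ↔ a ∈ s := by
  obtain rfl | ⟨b, rfl⟩ := hs.eq_empty_or_singleton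
  · exact ⟨none, by simp⟩
  · exact ⟨some b, by simp [eq_comm]⟩

theorem indep_iff_exists_transversal {m k : ℕ} {A : Finset (Fin m ⊕ (Fin k × Fin 2))} :
    (extremalMatroid m k).Indep (A : Set _) ↔ ∃ x, transversal x = A := by
  rw [extremalMatroid_indep_iff]
  constructor
  · rintro ⟨h, h'⟩
    obtain ⟨o, ho⟩ := exists_option_of_subsingleton h
    choose φ hφ using fun i => exists_option_of_subsingleton (h' i)
    refine ⟨(o, φ), Finset.ext ?_⟩
    rintro (a | ⟨i, b⟩)
    · simpa [inl_mem_transversal] using ho a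
    · simpa [inr_mem_transversal] using hφ i b
  · rintro ⟨x, rfl⟩
    refine ⟨fun a ha b hb => ?_, fun i a ha b hb => ?_⟩
    · simp only [Set.mem_preimage, Finset.mem_coe, inl_mem_transversal] at ha hb
      exact Option.some_injective _ (ha.symm.trans hb)
    · simp only [Set.mem_preimage, Finset.mem_coe, inr_mem_transversal] at ha hb
      exact Option.some_injective _ (ha.symm.trans hb)

theorem card_transversal {m k : ℕ} (x : Option (Fin m) × (Fin k → Option (Fin 2))) :
    (transversal x).card = x.1.toFinset.card + ∑ i, (x.2 i).toFinset.card := by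
  have h : (Finset.univ.filter fun p : Fin k × Fin 2 => x.2 p.1 = some p.2) =
      Finset.univ.biUnion fun i => (x.2 i).toFinset.image fun b => (i, b) := by
    ext ⟨i, b⟩
    simp
  rw [transversal, Finset.card_disjSum, h, Finset.card_biUnion]
  · simp only [Finset.card_image_of_injective _ (Prod.mk_right_injective _)]
  · intro i _ j _ hij
    rw [Function.onFun, Finset.disjoint_left]
    simp only [Finset.mem_image]
    rintro _ ⟨b, -, rfl⟩ ⟨c, -, h⟩
    exact hij (congrArg Prod.fst h).symm

theorem card_option_toFinset_le {β : Type*} (o : Option β) : o.toFinset.card ≤ 1 := by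
  cases o <;> simp

theorem card_transversal_le {m k : ℕ} (x : Option (Fin m) × (Fin k → Option (Fin 2))) :
    (transversal x).card ≤ k + 1 := by
  rw [card_transversal, add_comm]
  refine add_le_add ?_ (card_option_toFinset_le _)
  simpa using Finset.sum_le_sum fun i (_ : i ∈ Finset.univ) => card_option_toFinset_le (x.2 i)

theorem eRank_extremalMatroid (m k : ℕ) :
    (extremalMatroid (m + 1) k).eRank = ((k + 1 : ℕ) : ℕ∞) := by
  refine le_antisymm ?_ ?_
  · obtain ⟨B, hB⟩ := (extremalMatroid (m + 1) k).exists_isBase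
    obtain ⟨A, rfl⟩ := B.toFinite.exists_finset_coe
    obtain ⟨x, rfl⟩ := indep_iff_exists_transversal.1 hB.indep
    rw [← hB.encard_eq_eRank, Set.encard_coe_eq_coe_finsetCard]
    exact_mod_cast card_transversal_le x
  · have h := (indep_iff_exists_transversal.2
      ⟨(some (0 : Fin (m + 1)), fun _ : Fin k => some 0), rfl⟩).encard_le_eRank
    rw [Set.encard_coe_eq_coe_finsetCard, card_transversal] at h
    simpa [add_comm] using h

/-- Every element has a parallel partner in its own summand, and a coloop could be added to that
partner without losing independence. -/
theorem not_isColoop_extremalMatroid {m k : ℕ} (hm : 1 ≤ m)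
    (e : Fin (m + 1) ⊕ (Fin k × Fin 2)) : ¬ (extremalMatroid (m + 1) k).IsColoop e := by
  intro he
  obtain a | ⟨i, b⟩ := e
  · have : NeZero m := ⟨by omega⟩
    obtain ⟨a', ha'⟩ := exists_ne a
    have h := he.insert_indep_of_indep (I := {Sum.inl a'})
      (extremalMatroid_indep_iff.2 ⟨by simp [Set.Subsingleton], by simp [Set.Subsingleton]⟩)
    exact ha' ((extremalMatroid_indep_iff.1 h).1 (by simp) (by simp))
  · obtain ⟨b', hb'⟩ := exists_ne b
    have h := he.insert_indep_of_indep (I := {Sum.inr (i, b')})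
      (extremalMatroid_indep_iff.2 ⟨by simp [Set.Subsingleton], by
        simp +contextual [Set.Subsingleton]⟩)
    exact hb' ((extremalMatroid_indep_iff.1 h).2 i (by simp) (by simp))

theorem fNumber_extremalMatroid (m k j : ℕ) :
    fNumber (indepComplex (extremalMatroid m k)) j =
      (Finset.univ.filter fun x : Option (Fin m) × (Fin k → Option (Fin 2)) =>
        (transversal x).card = j).card := by
  rw [fNumber, ← Finset.card_image_of_injective _ (transversal_injective m k),
    ← Set.ncard_coe_finset]
  congr 1
  ext A
  simp only [Set.mem_ofPred_eq, mem_indepComplex, indep_iff_exists_transversal, Finset.coe_image,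
    Finset.coe_filter, Finset.mem_univ, true_and, Set.mem_image]
  constructor
  · rintro ⟨⟨x, rfl⟩, h⟩
    exact ⟨x, h, rfl⟩
  · rintro ⟨x, h, rfl⟩
    exact ⟨⟨x, rfl⟩, h⟩

/-- Summing over transversals instead of cardinalities splits the sum into a product over the
summands. A summand `U_{1,b}` gives `(X - 1) + b`: the empty choice plus `b` singletons. -/
theorem shiftedFPoly_extremalMatroid (m k : ℕ) :
    shiftedFPoly (extremalMatroid (m + 1) k) (k + 1) = extremalPoly (k + 1) m := by
  have hfib : shiftedFPoly (extremalMatroid (m + 1) k) (k + 1) =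
      ∑ x : Option (Fin (m + 1)) × (Fin k → Option (Fin 2)),
        (X - 1 : ℤ[X]) ^ (k + 1 - (transversal x).card) := by
    rw [shiftedFPoly, ← Finset.sum_fiberwise_of_maps_to (t := Finset.range (k + 1 + 1))
      (g := fun x => (transversal x).card)
      (fun x _ => Finset.mem_range.2 (Nat.lt_succ_of_le (card_transversal_le x)))]
    refine Finset.sum_congr rfl fun j _ => ?_
    rw [fNumber_extremalMatroid, ← nsmul_eq_mul, ← Finset.sum_const]
    refine Finset.sum_congr rfl fun x hx => ?_
    rw [(Finset.mem_filter.1 hx).2]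
  have hterm (x : Option (Fin (m + 1)) × (Fin k → Option (Fin 2))) :
      (X - 1 : ℤ[X]) ^ (k + 1 - (transversal x).card) =
        (X - 1) ^ (1 - x.1.toFinset.card) * ∏ i, (X - 1) ^ (1 - (x.2 i).toFinset.card) := by
    rw [Finset.prod_pow_eq_pow_sum, ← pow_add]
    congr 1
    -- Truncated subtraction is harmless, since each choice has at most one element.
    have h1 : ∑ i, (1 - (x.2 i).toFinset.card) + ∑ i, (x.2 i).toFinset.card = k := by
      rw [← Finset.sum_add_distrib]
      simp [Nat.sub_add_cancel (card_option_toFinset_le _)]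
    have h2 := card_option_toFinset_le x.1
    rw [card_transversal]
    omega
  rw [hfib, Finset.sum_congr rfl fun x _ => hterm x, Fintype.sum_prod_type]
  simp only [← Finset.mul_sum]
  rw [← Finset.sum_mul, ← Fintype.prod_sum (fun (_ : Fin k) (o : Option (Fin 2)) =>
    (X - 1 : ℤ[X]) ^ (1 - o.toFinset.card))]
  simp [extremalPoly, Fintype.sum_option]
  ring

theorem matroidH_extremalMatroid (m k : ℕ) (i : ℤ) :
    matroidH (extremalMatroid (m + 1) k) ((k + 1 : ℕ) - i) =
      intChoose k i * m + intChoose k (i - 1) := by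
  have h := eRank_extremalMatroid m k
  obtain hi | hi := lt_or_ge i 0
  · rw [matroidH_sub_of_neg h hi, intChoose_of_neg hi, intChoose_of_neg (by omega)]
    simp
  lift i to ℕ using hi
  obtain hik | hik := le_or_gt i (k + 1)
  · rw [matroidH_eq_coeff h hik, shiftedFPoly_extremalMatroid, coeff_extremalPoly_succ]
  · rw [matroidH_sub_of_lt (by exact_mod_cast hik),
        intChoose_eq_zero_of_notMem (Or.inr (by omega)),
      intChoose_eq_zero_of_notMem (Or.inr (by omega))]
    simp

end HVectors

theorem mainTheorem4 :
    (∀ {α : Type*} (M : Matroid α) [M.Finite] (r : ℕ),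
      M.eRank = r → (∀ e, ¬ M.IsColoop e) →
      ∀ i : ℤ, HVectors.matroidH M (r - i) ≤
        HVectors.intChoose ((r : ℤ) - 1) i * HVectors.matroidH M r
          + HVectors.intChoose ((r : ℤ) - 1) (i - 1)) ∧
    (∀ r h : ℕ, 1 ≤ r → 1 ≤ h →
      (HVectors.extremalMatroid (h + 1) (r - 1)).Finite ∧
      (HVectors.extremalMatroid (h + 1) (r - 1)).eRank = r ∧
      (∀ e, ¬ (HVectors.extremalMatroid (h + 1) (r - 1)).IsColoop e) ∧
      HVectors.matroidH (HVectors.extremalMatroid (h + 1) (r - 1)) r = h ∧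
      ∀ i : ℤ, HVectors.matroidH (HVectors.extremalMatroid (h + 1) (r - 1)) (r - i) =
        HVectors.intChoose ((r : ℤ) - 1) i
            * HVectors.matroidH (HVectors.extremalMatroid (h + 1) (r - 1)) r
          + HVectors.intChoose ((r : ℤ) - 1) (i - 1)) := by
  refine ⟨fun M _ r h hc i => HVectors.matroidH_le h hc i, fun r h hr hh => ?_⟩
  obtain ⟨k, rfl⟩ : ∃ k, r = k + 1 := ⟨r - 1, by omega⟩
  rw [Nat.add_sub_cancel]
  have htop : HVectors.matroidH (HVectors.extremalMatroid (h + 1) k) (k + 1 : ℕ) = h := by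
    simpa [HVectors.intChoose] using HVectors.matroidH_extremalMatroid h k 0
  refine ⟨inferInstance, HVectors.eRank_extremalMatroid h k,
    HVectors.not_isColoop_extremalMatroid hh, htop, fun i => ?_⟩
  rw [htop, HVectors.matroidH_extremalMatroid, Nat.cast_succ, add_sub_cancel_right]
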